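/- Let $m,n\ge 0$ be integers. Let $h$ be any word consisting of exactly $m$ east steps $\rightarrow$ and $m$ west steps $\leftarrow$, and let $v$ be any word consisting of exactly $n$ north steps $\uparrow$ and $n$ south steps $\downarrow$. A shuffle of $v$ and $h$ is an interleaving of the two words. The signed peak-count of a shuffle $\sigma$ is the number of occurrences in $\sigma$ of $\uparrow$ immediately followed by $\leftarrow$, minus the number of occurrences of $\rightarrow$ immediately followed by $\downarrow$; denote it by $\mathrm{spc}(\sigma)$. Let $$F(m,m,n,n)=\sum_{\sigma} x^{|\mathrm{spc}(\sigma)|}\in\mathbb{Z}[x],$$ where $\sigma$ ranges over all shuffles of $v$ and $h$. Then, for every choice of $v$ and $h$, the polynomial $F(m,m,n,n)$ is $(x+1)$-positive, i.e. it is a polynomial in $x+1$ with non-negative integer coefficients. More precisely, $$F(m,m,n,n)=\binom{m+n}{n}+2\sum_{i>0}(x+1)^i\sum_{0\le k<n}\binom{m+n}{k}\binom{m+n-k}{2n-2k}\binom{2n-2k-i-1}{n-k-1},$$ where $\binom{a}{b}=0$ if $a<0$ or $b>a$; in particular only finitely many $i$ contribute to the sum. (Hence $F(m,m,n,n)$ depends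 only on $m$ and $n$, and not on the choice of $v$ and $h$.) -/

import Mathlib

open Polynomial

namespace PathShuffle

/-- The four unit steps: north, south, east, west. -/
inductive Step where
  | up
  | down
  | right
  | left
  deriving DecidableEq

/-- `v` is a vertical path: a word in the vertical steps with exactly `u` steps north and
`d` steps south. -/
def IsVerticalPath (u d : ℕ) (v : List Step) : Prop :=
  (∀ s ∈ v, s = Step.up ∨ s = Step.down) ∧ v.count Step.up = u ∧ v.count Step.down = d

/-- `h` is a horizontal path: a word in the horizontal steps with exactly `r` steps east and
`l` steps west. -/
def IsHorizontalPath (r l : ℕ) (h : List Step) : Prop :=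
  (∀ s ∈ h, s = Step.right ∨ s = Step.left) ∧ h.count Step.right = r ∧ h.count Step.left = l

/-- The set of shuffles (interleavings) of two words. -/
def shuffles : List Step → List Step → Finset (List Step)
  | [], h => {h}
  | v, [] => {v}
  | a :: v, b :: h =>
      (shuffles v (b :: h)).image (fun σ => a :: σ) ∪
        (shuffles (a :: v) h).image (fun σ => b :: σ)
  termination_by v h => v.length + h.length

/-- The number of occurrences in `σ` of the step `a` immediately followed by the step `b`. -/
def adjCount (a b : Step) (σ : List Step) : ℕ :=
  (σ.zip σ.tail).count (a, b)

/-- The signed peak-count: the number of north-west corners minus the number of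
east-south corners. -/
def signedPeakCount (σ : List Step) : ℤ :=
  (adjCount Step.up Step.left σ : ℤ) - (adjCount Step.right Step.down σ : ℤ)

/-- The polynomial counting the shuffles of `v` and `h` according to the absolute value of
their signed peak-count. -/
noncomputable def peakPolynomial (v h : List Step) : ℤ[X] :=
  ∑ σ ∈ shuffles v h, X ^ (signedPeakCount σ).natAbs

/-- A polynomial in `ℤ[X]` is `(X + 1)`-positive if it is a polynomial in `X + 1` with
non-negative integer coefficients. -/
def IsXAddOnePositive (P : ℤ[X]) : Prop :=
  ∃ Q : ℕ[X], P = (Q.map (Nat.castRingHom ℤ)).comp (X + 1)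

/-- The binomial coefficient, with the convention that it vanishes when the upper entry is
negative (as it does when the lower entry exceeds a non-negative upper entry). -/
def binom (a : ℤ) (b : ℕ) : ℕ :=
  if 0 ≤ a then a.toNat.choose b else 0

end PathShuffle

/-! Removing first letters shows, by induction, that a vertical word with u north and d south steps
and a horizontal word with r east and l west steps have exactly C(u+r, u-s) C(d+l, d+s) shuffles of
signed peak-count s (`shuffleCount_eq`). The order of the letters drops out.

In the balanced case, with N = m+n, this is C(N, n-s) C(N, n+s), which is even in s. Sorting pairs
of subsets by the size k of their intersection gives the sum of C(N, k) C(N-k, 2n-2k) C(2n-2k,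
n-k+s) (`choose_mul_choose_eq_sum`). A convolution then expands C(2j, j+s), j = n-k > 0, in the
numbers C(i, s), the coefficients of x^s in (x+1)^i (`two_mul_sum_choose_mul_binom`). The term k = n
is the constant C(N, n). -/

/-! ### Binomial identities -/

open Finset in
theorem choose_mul_choose_eq_sum (N n s : ℕ) (hs : s ≤ n) :
    N.choose (n - s) * N.choose (n + s) =
      ∑ k ∈ range (n + 1), N.choose k * (N - k).choose (2 * n - 2 * k) *
        (2 * n - 2 * k).choose (n - k + s) := by
  rcases lt_or_ge N (n + s) with hN | hN
  · rw [Nat.choose_eq_zero_of_lt hN, mul_zero, eq_comm]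
    refine sum_eq_zero fun k hk => ?_
    rw [mem_range] at hk
    rcases lt_or_ge (n - k) s with h | h
    · rw [Nat.choose_eq_zero_of_lt (show 2 * n - 2 * k < n - k + s by omega), mul_zero]
    · rcases lt_or_ge N k with h' | h'
      · rw [Nat.choose_eq_zero_of_lt h', zero_mul, zero_mul]
      · rw [Nat.choose_eq_zero_of_lt (show N - k < 2 * n - 2 * k by omega), mul_zero, zero_mul]
  · have hsub : range (n - s + 1) ⊆ range (n + 1) := by
      intro k; simp only [mem_range]; omega
    rw [← sum_subset hsub]
    · have hV := Nat.add_choose_eq (n + s) (N - (n + s)) (n - s)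
      -- Vandermonde sorts the (n-s)-subsets by the size k of their intersection with a fixed
      -- (n+s)-subset.
      rw [Nat.add_sub_cancel' hN, Nat.sum_antidiagonal_eq_sum_range_succ_mk] at hV
      rw [hV, sum_mul]
      refine sum_congr rfl fun k hk => ?_
      rw [mem_range] at hk
      have h1 := Nat.choose_mul (n := N) (k := n + s) (s := k) (by omega)
      have h2 := Nat.choose_mul (n := N - k) (k := 2 * n - 2 * k) (s := n - k + s) (by omega)
      rw [show n + s - k = n - k + s by omega] at h1
      rw [show N - k - (n - k + s) = N - (n + s) by omega,
        show 2 * n - 2 * k - (n - k + s) = n - s - k by omega] at h2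
      calc _ = (N.choose (n + s) * (n + s).choose k) * (N - (n + s)).choose (n - s - k) := by
              dsimp only; ring
        _ = N.choose k * ((N - k).choose (n - k + s) * (N - (n + s)).choose (n - s - k)) := by
              rw [h1]; ring
        _ = _ := by rw [← h2]; ring
    · intro k hk hk'
      rw [mem_range] at hk hk'
      rw [Nat.choose_eq_zero_of_lt (show 2 * n - 2 * k < n - k + s by omega), mul_zero]

-- Sort the (s+t+1)-subsets of {0, ..., N} by the element i that has exactly s chosen elements below
-- it. In the induction t stays free, since Pascal's rule lowers it.
open Finset in
theorem sum_range_choose_mul_choose_sub (N s t : ℕ) :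
    ∑ i ∈ range (N + 1), i.choose s * (N - i).choose t = (N + 1).choose (s + t + 1) := by
  induction N generalizing t with
  | zero =>
    rcases s with _ | s <;> rcases t with _ | t <;> simp [Nat.choose_eq_zero_of_lt]
  | succ N ih =>
    rcases t with _ | t
    · rw [sum_range_succ]
      have : ∀ i ∈ range (N + 1), i.choose s * (N + 1 - i).choose 0 =
          i.choose s * (N - i).choose 0 := fun i _ => by simp
      rw [sum_congr rfl this, ih, Nat.choose_succ_succ (N + 1), Nat.choose_zero_right, mul_one,
        add_comm]
    · rw [sum_range_succ]
      have : ∀ i ∈ range (N + 1), i.choose s * (N + 1 - i).choose (t + 1) =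
          i.choose s * (N - i).choose t + i.choose s * (N - i).choose (t + 1) := by
        intro i hi
        rw [mem_range] at hi
        rw [Nat.sub_add_comm (by omega), Nat.choose_succ_succ]; ring
      rw [sum_congr rfl this, sum_add_distrib, ih, ih, Nat.sub_self, Nat.choose_zero_succ,
        mul_zero, add_zero, show s + (t + 1) + 1 = (s + t + 1) + 1 by ring,
        Nat.choose_succ_succ (N + 1) (s + t + 1)]

namespace PathShuffle

theorem binom_eq_choose (j i : ℕ) (hi : i < 2 * j) (a : ℤ)
    (ha : a = 2 * (j : ℤ) - i - 1) : binom a (j - 1) = (2 * j - 1 - i).choose (j - 1) := by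
  have : a = ((2 * j - 1 - i : ℕ) : ℤ) := by omega
  simp [binom, this]

theorem binom_eq_zero (j i : ℕ) (hi : j < i) (a : ℤ)
    (ha : a = 2 * (j : ℤ) - i - 1) : binom a (j - 1) = 0 := by
  unfold binom
  split_ifs with h
  · exact Nat.choose_eq_zero_of_lt (by omega)
  · rfl

-- With j = n-k, the sum taken from i = 0 would be C(2j, j+s). The missing term i = 0 matters only
-- for s = 0, where it is C(2j-1, j-1), half of C(2j, j); hence the two cases on the right.
open Finset in
theorem two_mul_sum_choose_mul_binom (n k s : ℕ) (hk : k < n) :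
    2 * ∑ i ∈ Icc 1 n, i.choose s * binom (2 * (n : ℤ) - 2 * (k : ℤ) - (i : ℤ) - 1) (n - k - 1) =
      (if s = 0 then 1 else 2) * (2 * n - 2 * k).choose (n - k + s) := by
  obtain ⟨j, rfl⟩ : ∃ j, n = k + (j + 1) := ⟨n - k - 1, by omega⟩
  have e1 : k + (j + 1) - k = j + 1 := by omega
  have e2 : 2 * (k + (j + 1)) - 2 * k = 2 * j + 2 := by omega
  rw [e1, e2]
  have hsub : Icc 1 (j + 1) ⊆ Icc 1 (k + (j + 1)) := Icc_subset_Icc le_rfl (by omega)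
  rw [← sum_subset hsub]
  swap
  · intro i hi hi'
    rw [mem_Icc] at hi hi'
    rw [binom_eq_zero (j + 1) i (by omega) _ (by push_cast; ring), mul_zero]
  have hT := sum_range_choose_mul_choose_sub (2 * j + 1) s j
  -- The terms with i > j+1 vanish, so the range can be lengthened to fit the convolution.
  have hsub' : Icc 1 (j + 1) ⊆ Ico 1 (2 * j + 2) := by
    intro i; simp only [mem_Icc, mem_Ico]; omega
  have hS : ∑ i ∈ Icc 1 (j + 1), i.choose s *
      binom (2 * ((k + (j + 1) : ℕ) : ℤ) - 2 * (k : ℤ) - (i : ℤ) - 1) (j + 1 - 1) =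
      ∑ i ∈ Ico 1 (2 * j + 2), i.choose s * (2 * j + 1 - i).choose j := by
    rw [← sum_subset hsub']
    · refine sum_congr rfl fun i hi => ?_
      rw [mem_Icc] at hi
      rw [binom_eq_choose (j + 1) i (by omega) _ (by push_cast; ring)]
      congr 2
    · intro i hi hi'
      rw [mem_Ico] at hi
      rw [mem_Icc] at hi'
      rw [Nat.choose_eq_zero_of_lt (show 2 * j + 1 - i < j by omega), mul_zero]
  rw [hS]
  rw [range_eq_Ico, sum_eq_sum_Ico_succ_bot (by omega)] at hT
  rcases s with _ | s
  · simp only [Nat.choose_self, Nat.sub_zero, if_true, one_mul, zero_add, add_zero] at hT ⊢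
    have h1 : (2 * j + 1 + 1).choose (j + 1) = (2 * j + 1).choose j + (2 * j + 1).choose (j + 1) :=
      Nat.choose_succ_succ _ _
    have h2 : (2 * j + 1).choose (j + 1) = (2 * j + 1).choose j := by
      rw [← Nat.choose_symm (show j ≤ 2 * j + 1 by omega)]
      congr 1; omega
    simp only [one_mul, Nat.choose_zero_right] at hT ⊢
    rw [show 2 * j + 2 = 2 * j + 1 + 1 from rfl]
    omega
  · simp only [Nat.choose_zero_succ, zero_mul, zero_add, Nat.succ_ne_zero, if_false] at hT ⊢
    rw [show 2 * j + 2 = 2 * j + 1 + 1 from rfl, hT]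
    congr 2; ring

/-- The binomial coefficient with an integer lower entry, zero when that entry is negative. -/
def intChoose (a : ℕ) (b : ℤ) : ℤ := if 0 ≤ b then (a.choose b.toNat : ℤ) else 0

theorem intChoose_natCast (a b : ℕ) : intChoose a b = a.choose b := by simp [intChoose]

theorem intChoose_of_neg (a : ℕ) {b : ℤ} (hb : b < 0) : intChoose a b = 0 := by
  simp [intChoose, hb]

theorem intChoose_of_lt (a : ℕ) {b : ℤ} (hb : (a : ℤ) < b) : intChoose a b = 0 := by
  lift b to ℕ using by omega
  rw [intChoose_natCast, Nat.choose_eq_zero_of_lt (by omega), Nat.cast_zero]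

/-- Allowing integer lower entries makes Pascal's rule hold without exceptions, so s can be shifted
freely. -/
theorem intChoose_succ (a : ℕ) (b : ℤ) :
    intChoose (a + 1) b = intChoose a b + intChoose a (b - 1) := by
  rcases lt_trichotomy b 0 with h | rfl | h
  · rw [intChoose_of_neg _ h, intChoose_of_neg _ h, intChoose_of_neg _ (by omega), add_zero]
  · simp [intChoose]
  · obtain ⟨c, rfl⟩ : ∃ c : ℕ, b = c + 1 := ⟨(b - 1).toNat, by omega⟩
    rw [add_sub_cancel_right, ← Nat.cast_succ, intChoose_natCast, intChoose_natCast,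
      intChoose_natCast, Nat.succ_eq_add_one, Nat.choose_succ_succ]
    push_cast; ring

/-- This and the next lemma serve the base cases, where one word is empty and the peak-count is 0.
-/
theorem intChoose_mul_intChoose_neg (a b : ℕ) (s : ℤ) :
    intChoose a (-s) * intChoose b s = if 0 = s then 1 else 0 := by
  rcases lt_trichotomy s 0 with h | rfl | h
  · rw [intChoose_of_neg b h, mul_zero, if_neg h.ne']
  · simp [intChoose]
  · rw [intChoose_of_neg a (by omega), zero_mul, if_neg h.ne]

theorem intChoose_sub_mul_intChoose_add (a b : ℕ) (s : ℤ) :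
    intChoose a (a - s) * intChoose b (b + s) = if 0 = s then 1 else 0 := by
  rcases lt_trichotomy s 0 with h | rfl | h
  · rw [intChoose_of_lt a (by omega), zero_mul, if_neg h.ne']
  · simp [intChoose]
  · rw [intChoose_of_lt b (by omega), mul_zero, if_neg h.ne]

end PathShuffle

/-! ### Distribution of the signed peak-count -/

namespace PathShuffle

theorem shuffles_nil_left (h : List Step) : shuffles [] h = {h} := by simp [shuffles]

theorem shuffles_nil_right (v : List Step) : shuffles v [] = {v} := by
  cases v <;> simp [shuffles]

theorem sum_shuffles_cons_cons {M : Type*} [AddCommMonoid M] (f : List Step → M) {a b : Step}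
    (hab : a ≠ b) (v h : List Step) :
    ∑ σ ∈ shuffles (a :: v) (b :: h), f σ =
      ∑ σ ∈ shuffles v (b :: h), f (a :: σ) + ∑ σ ∈ shuffles (a :: v) h, f (b :: σ) := by
  rw [shuffles, Finset.sum_union, Finset.sum_image, Finset.sum_image]
  · intro x _ y _ hxy; exact (List.cons.inj hxy).2
  · intro x _ y _ hxy; exact (List.cons.inj hxy).2
  · rw [Finset.disjoint_left]
    intro σ h1 h2
    obtain ⟨x, -, rfl⟩ := Finset.mem_image.1 h1
    obtain ⟨y, -, hy⟩ := Finset.mem_image.1 h2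
    exact hab (List.cons.inj hy).1.symm

theorem signedPeakCount_cons_cons (c d : Step) (σ : List Step) :
    signedPeakCount (c :: d :: σ) = signedPeakCount (d :: σ) +
      ((if c = .up ∧ d = .left then 1 else 0) - (if c = .right ∧ d = .down then 1 else 0)) := by
  simp only [signedPeakCount, adjCount, List.tail_cons, List.zip_cons_cons, List.count_cons,
    beq_iff_eq, Prod.mk.injEq]
  push_cast; ring

theorem signedPeakCount_singleton (c : Step) : signedPeakCount [c] = 0 := by
  simp [signedPeakCount, adjCount]

theorem signedPeakCount_nil : signedPeakCount [] = 0 := by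
  simp [signedPeakCount, adjCount]

theorem signedPeakCount_down_cons (σ : List Step) :
    signedPeakCount (.down :: σ) = signedPeakCount σ := by
  cases σ <;> simp [signedPeakCount_cons_cons, signedPeakCount_singleton, signedPeakCount_nil]

theorem signedPeakCount_left_cons (σ : List Step) :
    signedPeakCount (.left :: σ) = signedPeakCount σ := by
  cases σ <;> simp [signedPeakCount_cons_cons, signedPeakCount_singleton, signedPeakCount_nil]

theorem signedPeakCount_eq_zero_of_vertical (v : List Step)
    (hv : ∀ s ∈ v, s = Step.up ∨ s = Step.down) : signedPeakCount v = 0 := by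
  induction v with
  | nil => exact signedPeakCount_nil
  | cons a v ih =>
    rcases v with _ | ⟨b, v⟩
    · exact signedPeakCount_singleton a
    · rw [signedPeakCount_cons_cons, ih fun s hs => hv s (List.mem_cons_of_mem _ hs)]
      simp only [List.forall_mem_cons] at hv
      rcases hv with ⟨rfl | rfl, rfl | rfl, -⟩ <;> simp

theorem signedPeakCount_eq_zero_of_horizontal (h : List Step)
    (hh : ∀ s ∈ h, s = Step.right ∨ s = Step.left) : signedPeakCount h = 0 := by
  induction h with
  | nil => exact signedPeakCount_nil
  | cons a h ih =>
    rcases h with _ | ⟨b, h⟩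
    · exact signedPeakCount_singleton a
    · rw [signedPeakCount_cons_cons, ih fun s hs => hh s (List.mem_cons_of_mem _ hs)]
      simp only [List.forall_mem_cons] at hh
      rcases hh with ⟨rfl | rfl, rfl | rfl, -⟩ <;> simp

/-- The number of shuffles of `v` and `h` with signed peak-count `s`. -/
def shuffleCount (v h : List Step) (s : ℤ) : ℤ :=
  ∑ σ ∈ shuffles v h, if signedPeakCount σ = s then 1 else 0

/-- The number of shuffles of `v` and `h` whose signed peak-count is `s` once the step `c` is
put in front. -/
def shuffleCountAfter (c : Step) (v h : List Step) (s : ℤ) : ℤ :=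
  ∑ σ ∈ shuffles v h, if signedPeakCount (c :: σ) = s then 1 else 0

theorem shuffleCount_cons_cons {a b : Step} (hab : a ≠ b) (v h : List Step) (s : ℤ) :
    shuffleCount (a :: v) (b :: h) s =
      shuffleCountAfter a v (b :: h) s + shuffleCountAfter b (a :: v) h s :=
  sum_shuffles_cons_cons _ hab v h

theorem shuffleCountAfter_down (v h : List Step) (s : ℤ) :
    shuffleCountAfter .down v h s = shuffleCount v h s := by
  simp [-Finset.sum_boole, shuffleCountAfter, shuffleCount, signedPeakCount_down_cons]

theorem shuffleCountAfter_left (v h : List Step) (s : ℤ) :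
    shuffleCountAfter .left v h s = shuffleCount v h s := by
  simp [-Finset.sum_boole, shuffleCountAfter, shuffleCount, signedPeakCount_left_cons]

theorem shuffleCountAfter_up_right (v h : List Step)
    (hv : ∀ s ∈ v, s = Step.up ∨ s = Step.down) (s : ℤ) :
    shuffleCountAfter .up v (.right :: h) s = shuffleCount v (.right :: h) s := by
  rcases v with _ | ⟨a, v⟩
  · simp [-Finset.sum_boole, shuffleCountAfter, shuffleCount, shuffles_nil_left,
      signedPeakCount_cons_cons]
  · have ha := hv a List.mem_cons_self
    have hab : a ≠ .right := by rcases ha with rfl | rfl <;> decide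
    have hal : a ≠ .left := by rcases ha with rfl | rfl <;> decide
    simp only [shuffleCountAfter, shuffleCount]
    rw [sum_shuffles_cons_cons _ hab, sum_shuffles_cons_cons _ hab]
    simp [signedPeakCount_cons_cons, hal]

theorem shuffleCountAfter_right_up (v h : List Step)
    (hh : ∀ s ∈ h, s = Step.right ∨ s = Step.left) (s : ℤ) :
    shuffleCountAfter .right (.up :: v) h s = shuffleCount (.up :: v) h s := by
  rcases h with _ | ⟨b, h⟩
  · simp [-Finset.sum_boole, shuffleCountAfter, shuffleCount, shuffles_nil_right,
      signedPeakCount_cons_cons]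
  · have hb := hh b List.mem_cons_self
    have hab : .up ≠ b := by rcases hb with rfl | rfl <;> decide
    have hbd : b ≠ .down := by rcases hb with rfl | rfl <;> decide
    simp only [shuffleCountAfter, shuffleCount]
    rw [sum_shuffles_cons_cons _ hab, sum_shuffles_cons_cons _ hab]
    simp [signedPeakCount_cons_cons, hbd]

/-- Only the shuffles that begin with the west step gain a peak; their contribution moves from s to
s-1. -/
theorem shuffleCountAfter_up_left (v h : List Step)
    (hv : ∀ s ∈ v, s = Step.up ∨ s = Step.down) (s : ℤ) :
    shuffleCountAfter .up v (.left :: h) s =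
      shuffleCount v (.left :: h) s + shuffleCount v h (s - 1) - shuffleCount v h s := by
  rcases v with _ | ⟨a, v⟩
  · simp [-Finset.sum_boole, shuffleCountAfter, shuffleCount, shuffles_nil_left,
      signedPeakCount_cons_cons,
      signedPeakCount_left_cons, eq_sub_iff_add_eq]
  · have ha := hv a List.mem_cons_self
    have hal : a ≠ .left := by rcases ha with rfl | rfl <;> decide
    simp only [shuffleCountAfter, shuffleCount]
    rw [sum_shuffles_cons_cons _ hal, sum_shuffles_cons_cons _ hal]
    simp [-Finset.sum_boole, signedPeakCount_cons_cons,
      signedPeakCount_left_cons, hal, eq_sub_iff_add_eq]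
    ring

theorem shuffleCountAfter_right_down (v h : List Step)
    (hh : ∀ s ∈ h, s = Step.right ∨ s = Step.left) (s : ℤ) :
    shuffleCountAfter .right (.down :: v) h s =
      shuffleCount (.down :: v) h s + shuffleCount v h (s + 1) - shuffleCount v h s := by
  rcases h with _ | ⟨b, h⟩
  · simp [-Finset.sum_boole, shuffleCountAfter, shuffleCount, shuffles_nil_right,
      signedPeakCount_cons_cons,
      signedPeakCount_down_cons, ← sub_eq_add_neg, sub_eq_iff_eq_add]
  · have hb := hh b List.mem_cons_self
    have hbd : .down ≠ b := by rcases hb with rfl | rfl <;> decide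
    simp only [shuffleCountAfter, shuffleCount]
    rw [sum_shuffles_cons_cons _ hbd, sum_shuffles_cons_cons _ hbd]
    simp [-Finset.sum_boole, signedPeakCount_cons_cons,
      signedPeakCount_down_cons, hbd.symm, ← sub_eq_add_neg,
      sub_eq_iff_eq_add]
    ring

/-- The distribution of the signed peak-count depends only on the numbers of steps of each kind. -/
theorem shuffleCount_eq (v h : List Step) (hv : ∀ s ∈ v, s = Step.up ∨ s = Step.down)
    (hh : ∀ s ∈ h, s = Step.right ∨ s = Step.left) (s : ℤ) :
    shuffleCount v h s =
      intChoose (v.count .up + h.count .right) (v.count .up - s) *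
        intChoose (v.count .down + h.count .left) (v.count .down + s) := by
  -- The corner corrections delete a letter from both words and shift s, so `h` and `s` must vary.
  induction v generalizing h s with
  | nil =>
    simp [-Finset.sum_boole, shuffleCount, shuffles_nil_left,
      signedPeakCount_eq_zero_of_horizontal h hh,
      intChoose_mul_intChoose_neg]
  | cons a v ihv =>
    induction h generalizing s with
    | nil =>
      simp only [shuffleCount, shuffles_nil_right, Finset.sum_singleton,
        signedPeakCount_eq_zero_of_vertical _ hv, List.count_nil, add_zero,
        intChoose_sub_mul_intChoose_add]
    | cons b h ihh =>
      have hv' := (List.forall_mem_cons.1 hv).2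
      have hh' := (List.forall_mem_cons.1 hh).2
      have ihh := ihh hh'
      have ihv1 := ihv (b :: h) hv' hh
      have ihv2 := ihv h hv' hh'
      -- Each of the four pairs of first letters reduces to Pascal's rule.
      rcases (List.forall_mem_cons.1 hv).1 with rfl | rfl <;>
        rcases (List.forall_mem_cons.1 hh).1 with rfl | rfl
      · rw [shuffleCount_cons_cons (by decide), shuffleCountAfter_up_right v h hv',
          shuffleCountAfter_right_up v h hh', ihh, ihv1]
        simp only [List.count_cons_self, List.count_cons_of_ne, ne_eq, reduceCtorEq,
          not_false_eq_true, ← add_assoc, add_right_comm _ 1 (h.count Step.right)]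
        rw [intChoose_succ (_ + 1), Nat.cast_succ, add_sub_right_comm _ (1 : ℤ) s,
          add_sub_cancel_right]
        ring
      · rw [shuffleCount_cons_cons (by decide), shuffleCountAfter_up_left v h hv',
          shuffleCountAfter_left, ihh, ihv1, ihv2, ihv2]
        simp only [List.count_cons_self, List.count_cons_of_ne, ne_eq, reduceCtorEq,
          not_false_eq_true, ← add_assoc, add_right_comm _ 1 (h.count Step.right)]
        simp only [intChoose_succ, Nat.cast_succ, ← add_sub_assoc, sub_sub_eq_add_sub,
          add_sub_right_comm _ (1 : ℤ) s, add_sub_cancel_right]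
        ring
      · rw [shuffleCount_cons_cons (by decide), shuffleCountAfter_down,
          shuffleCountAfter_right_down v h hh', ihh, ihv1, ihv2, ihv2]
        simp only [List.count_cons_self, List.count_cons_of_ne, ne_eq, reduceCtorEq,
          not_false_eq_true, ← add_assoc, add_right_comm _ 1 (h.count Step.left)]
        simp only [intChoose_succ, Nat.cast_succ, ← sub_sub, add_right_comm _ (1 : ℤ) s,
          add_sub_cancel_right]
        ring
      · rw [shuffleCount_cons_cons (by decide), shuffleCountAfter_down,
          shuffleCountAfter_left, ihh, ihv1]
        simp only [List.count_cons_self, List.count_cons_of_ne, ne_eq, reduceCtorEq,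
          not_false_eq_true, ← add_assoc, add_right_comm _ 1 (h.count Step.left)]
        rw [intChoose_succ (_ + 1) (_ + s), Nat.cast_succ, add_right_comm _ (1 : ℤ) s,
          add_sub_cancel_right]
        ring

end PathShuffle

/-! ### Coefficients of the peak polynomial -/

namespace PathShuffle

open Finset in
theorem coeff_peakPolynomial (m n : ℕ) (v h : List Step) (hv : IsVerticalPath n n v)
    (hh : IsHorizontalPath m m h) (s : ℕ) :
    (peakPolynomial v h).coeff s = (if s = 0 then 1 else 2) *
      ((∑ k ∈ range (n + 1), (m + n).choose k * (m + n - k).choose (2 * n - 2 * k) *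
        (2 * n - 2 * k).choose (n - k + s) : ℕ) : ℤ) := by
  obtain ⟨hv, hu, hd⟩ := hv
  obtain ⟨hh, hr, hl⟩ := hh
  have key : ∀ t : ℤ, shuffleCount v h t =
      intChoose (m + n) (n - t) * intChoose (m + n) (n + t) := by
    intro t
    rw [shuffleCount_eq v h hv hh, hu, hd, hr, hl, add_comm n m]
  have hs : intChoose (m + n) (n - s) * intChoose (m + n) (n + s) =
      ((∑ k ∈ range (n + 1), (m + n).choose k * (m + n - k).choose (2 * n - 2 * k) *
        (2 * n - 2 * k).choose (n - k + s) : ℕ) : ℤ) := by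
    rcases le_or_gt s n with h | h
    · rw [← choose_mul_choose_eq_sum _ _ _ h, ← Nat.cast_sub h, ← Nat.cast_add,
        intChoose_natCast, intChoose_natCast, Nat.cast_mul]
    · rw [intChoose_of_neg _ (by omega), zero_mul, eq_comm, Nat.cast_eq_zero]
      refine sum_eq_zero fun k hk => ?_
      rw [Nat.choose_eq_zero_of_lt (show 2 * n - 2 * k < n - k + s by omega), mul_zero]
  rw [← hs, peakPolynomial, finsetSum_coeff]
  simp only [coeff_X_pow]
  split_ifs with h0
  · subst h0
    rw [one_mul, Nat.cast_zero, ← key, shuffleCount]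
    refine sum_congr rfl fun σ _ => if_congr ?_ rfl rfl
    rw [eq_comm, Int.natAbs_eq_zero]
  -- For s > 0 the coefficient collects peak-counts s and -s, which are equally frequent.
  · have h1 := key s
    have h2 := key (-s)
    rw [sub_neg_eq_add, ← sub_eq_add_neg, mul_comm, ← h1] at h2
    rw [two_mul, ← h1]
    nth_rewrite 2 [← h2]
    rw [shuffleCount, shuffleCount, ← sum_add_distrib]
    refine sum_congr rfl fun σ _ => ?_
    split_ifs <;> omega

/-- The coefficient of `(X + 1) ^ i`, up to a factor two, in the peak polynomial. -/
def peakCoeff (m n i : ℕ) : ℕ :=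
  ∑ k ∈ Finset.range n, (m + n).choose k * (m + n - k).choose (2 * n - 2 * k) *
    binom (2 * (n : ℤ) - 2 * (k : ℤ) - (i : ℤ) - 1) (n - k - 1)

theorem peakCoeff_eq_zero (m n i : ℕ) (hi : n < i) : peakCoeff m n i = 0 := by
  refine Finset.sum_eq_zero fun k hk => ?_
  rw [Finset.mem_range] at hk
  rw [binom_eq_zero (n - k) i (by omega) _ (by omega), mul_zero]

open Finset in
theorem peakPolynomial_eq (m n : ℕ) (v h : List Step) (hv : IsVerticalPath n n v)
    (hh : IsHorizontalPath m m h) :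
    peakPolynomial v h = ((m + n).choose n : ℤ[X]) +
      2 * ∑ i ∈ Icc 1 n, (X + 1 : ℤ[X]) ^ i * (peakCoeff m n i : ℤ[X]) := by
  ext s
  rw [coeff_peakPolynomial m n v h hv hh, coeff_add, coeff_ofNat_mul, finsetSum_coeff]
  simp only [coeff_mul_natCast, coeff_X_add_one_pow, coeff_natCast_ite]
  have : 2 * ∑ i ∈ Icc 1 n, i.choose s * peakCoeff m n i =
      ∑ k ∈ range n, (if s = 0 then 1 else 2) * ((m + n).choose k *
        (m + n - k).choose (2 * n - 2 * k) * (2 * n - 2 * k).choose (n - k + s)) := by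
    simp only [peakCoeff, mul_sum]
    rw [sum_comm]
    refine sum_congr rfl fun k hk => ?_
    have := two_mul_sum_choose_mul_binom n k s (mem_range.1 hk)
    rw [mul_left_comm, ← this, mul_sum, mul_sum]
    refine sum_congr rfl fun i _ => ?_
    ring
  have := congrArg (Nat.cast : ℕ → ℤ) this
  push_cast at this ⊢
  -- The split-off term k = n contains C(0, s), so it contributes only to the constant coefficient.
  rw [this, sum_range_succ, mul_add, mul_sum, add_comm]
  congr 1
  rcases s with _ | s <;> simp

end PathShuffle

theorem mainTheorem3 (m n : ℕ) (v h : List PathShuffle.Step)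
    (hv : PathShuffle.IsVerticalPath n n v) (hh : PathShuffle.IsHorizontalPath m m h) :
    PathShuffle.IsXAddOnePositive (PathShuffle.peakPolynomial v h) ∧
    {i : ℕ | 0 < i ∧ (∑ k ∈ Finset.range n, (m + n).choose k * (m + n - k).choose (2 * n - 2 * k) *
        PathShuffle.binom (2 * (n : ℤ) - 2 * (k : ℤ) - (i : ℤ) - 1) (n - k - 1)) ≠ 0}.Finite ∧
    PathShuffle.peakPolynomial v h =
      ((m + n).choose n : ℤ[X]) +
        2 * ∑ᶠ (i : ℕ) (_ : 0 < i), (X + 1 : ℤ[X]) ^ i *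
          ((∑ k ∈ Finset.range n, (m + n).choose k * (m + n - k).choose (2 * n - 2 * k) *
            PathShuffle.binom (2 * (n : ℤ) - 2 * (k : ℤ) - (i : ℤ) - 1) (n - k - 1) : ℕ) :
              ℤ[X]) := by
  have hP := PathShuffle.peakPolynomial_eq m n v h hv hh
  refine ⟨⟨((m + n).choose n : ℕ[X]) +
      2 * ∑ i ∈ Finset.Icc 1 n, X ^ i * (PathShuffle.peakCoeff m n i : ℕ[X]), ?_⟩, ?_, ?_⟩
  · rw [hP]
    simp [Polynomial.map_sum, Polynomial.sum_comp]
  · refine (Set.finite_Iic n).subset fun i hi => ?_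
    by_contra hlt
    exact hi.2 (PathShuffle.peakCoeff_eq_zero m n i (not_le.1 hlt))
  · rw [hP]
    congr 2
    symm
    -- The summands vanish for i > n, so the finite sum over 1 ≤ i ≤ n is the whole sum.
    refine finsum_mem_eq_sum_of_inter_support_eq (s := {i : ℕ | 0 < i})
      (fun i => (X + 1 : ℤ[X]) ^ i * (PathShuffle.peakCoeff m n i : ℤ[X])) ?_
    ext i
    simp only [Set.mem_inter_iff, Set.mem_ofPred_eq, Function.mem_support, Finset.coe_Icc,
      Set.mem_Icc]
    refine and_congr_left fun hi => ⟨fun h0 => ⟨h0, ?_⟩, fun h0 => h0.1⟩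
    by_contra hlt
    exact hi (by rw [PathShuffle.peakCoeff_eq_zero m n i (not_le.1 hlt), Nat.cast_zero, mul_zero])
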